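/- Let $n\ge 2$, let $\mathcal P_n$ be the complex vector space of all complex polynomials of degree at most $n$, let $D:\mathcal P_n\to\mathcal P_n$ be differentiation, and let $$T = I+\alpha_2D^2+\cdots+\alpha_nD^n,\qquad \alpha_2,\dots,\alpha_n\in\mathbb C .$$ For a nonconstant $f\in\mathcal P_n$ let $Z(f)$ be the multiset of its roots, and let $$\tau(f)=\min\{|w-v| : f(w)=0,\ f'(v)=0,\ v\ne w\},$$ with the convention $\tau(f)=+\infty$ if there is no such pair $(w,v)$. For multisets $A=\{a_1,\dots,a_m\}$ and $B=\{b_1,\dots,b_m\}$ of complex numbers of the same size $m\ge 1$ let $$d_F(A,B)=\min_{\sigma}\max_{1\le k\le m}|a_k-b_{\sigma(k)}|$$ be their Fréchet distance, where $\sigma$ runs over all permutations of $\{1,\dots,m\}$. Then for every $\varepsilon>0$ there exists $C_T(\varepsilon)>0$ such that for every nonconstant $f\in\mathcal P_n$ with simple roots the following holds: if $\tau(f)>C_T(\varepsilon)$, then $Z(f)$ and $Z(Tf)$ have the same size and $d_F\bigl(Z(f),Z(Tf)\bigr)<\varepsilon$. -/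

import Mathlib

open scoped ENNReal

namespace RootStability

/-- The `(n+1)`-dimensional complex vector space of all polynomials of degree at most `n`. -/
noncomputable abbrev PolyLE (n : ℕ) : Submodule ℂ (Polynomial ℂ) := Polynomial.degreeLE ℂ (n : WithBot ℕ)

theorem derivative_mem_polyLE (n : ℕ) :
    ∀ f ∈ PolyLE n, (Polynomial.derivative : Polynomial ℂ →ₗ[ℂ] Polynomial ℂ) f ∈ PolyLE n := by
  intro f hf
  rw [Polynomial.mem_degreeLE] at hf ⊢
  exact (Polynomial.degree_derivative_le).trans hf

/-- The differentiation operator `D` as a linear operator on the polynomials of degree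
at most `n`. -/
noncomputable def diffOp (n : ℕ) : PolyLE n →ₗ[ℂ] PolyLE n :=
  (Polynomial.derivative : Polynomial ℂ →ₗ[ℂ] Polynomial ℂ).restrict (derivative_mem_polyLE n)

/-- The set of roots of a polynomial. -/
def zeroSet (f : Polynomial ℂ) : Set ℂ := {w | f.eval w = 0}

/-- `τ(f)`: the minimal distance `|w - v|` between a root `w` of `f` and a root `v ≠ w` of `f'`.
It is `∞` if there are no such pairs (for instance if `f` has degree one). -/
noncomputable def tau (f : Polynomial ℂ) : ℝ≥0∞ :=
  ⨅ w ∈ zeroSet f, ⨅ v ∈ zeroSet (Polynomial.derivative f) \ {w}, ENNReal.ofReal ‖w - v‖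

/-- The Fréchet distance `min_σ max_k |u k - v (σ k)|` of two `m`-tuples of complex numbers. -/
noncomputable def frechetDistFun {m : ℕ} (u v : Fin m → ℂ) : ℝ≥0∞ :=
  ⨅ σ : Equiv.Perm (Fin m), ⨆ k : Fin m, ENNReal.ofReal ‖u k - v (σ k)‖

/-- The Fréchet distance of two finite multisets of complex numbers: that of any enumerations
`u`, `v` of `A`, `B` by the same index set (see `frechetDist_map`).  It is `∞` if `A` and `B` have
different sizes (see `frechetDist_eq_top`). -/
noncomputable def frechetDist (A B : Multiset ℂ) : ℝ≥0∞ :=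
  ⨅ (m : ℕ) (u : Fin m → ℂ) (v : Fin m → ℂ)
    (_ : Multiset.map u Finset.univ.val = A) (_ : Multiset.map v Finset.univ.val = B),
    frechetDistFun u v

theorem exists_perm_of_map_eq {m : ℕ} {u v : Fin m → ℂ}
    (h : Multiset.map u Finset.univ.val = Multiset.map v Finset.univ.val) :
    ∃ σ : Equiv.Perm (Fin m), u = v ∘ σ := by
  have hc : ∀ c : ℂ, Nonempty ({i // u i = c} ≃ {i // v i = c}) := by
    intro c
    have h1 := congrArg (Multiset.count c) h
    simp only [Multiset.count_map] at h1
    refine ⟨Fintype.equivOfCardEq ?_⟩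
    rw [Fintype.card_subtype, Fintype.card_subtype]
    simpa [Finset.card_def, Finset.filter_val, eq_comm] using h1
  let e : ∀ c : ℂ, {i // u i = c} ≃ {i // v i = c} := fun c => Classical.choice (hc c)
  refine ⟨Equiv.ofFiberEquiv e, funext fun i => ?_⟩
  exact (Equiv.ofFiberEquiv_map e i).symm

/-- The distance of multisets does not depend on the chosen enumerations. -/
theorem frechetDist_map {m : ℕ} (u v : Fin m → ℂ) :
    frechetDist (Multiset.map u Finset.univ.val) (Multiset.map v Finset.univ.val)
      = frechetDistFun u v := by
  apply le_antisymm
  · exact iInf_le_of_le m (iInf_le_of_le u (iInf_le_of_le v (iInf_le_of_le rfl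
      (iInf_le_of_le rfl le_rfl))))
  · refine le_iInf fun m' => le_iInf fun u' => le_iInf fun v' => le_iInf fun hu => le_iInf fun hv => ?_
    have hm : m' = m := by simpa using congrArg Multiset.card hu
    subst hm
    obtain ⟨a, rfl⟩ := exists_perm_of_map_eq hu
    obtain ⟨b, rfl⟩ := exists_perm_of_map_eq hv
    refine le_iInf fun σ => iInf_le_of_le (a.symm.trans (σ.trans b)) (iSup_le fun k => ?_)
    refine le_iSup_of_le (a.symm k) ?_
    simp

/-- Multisets of different sizes have infinite distance. -/
theorem frechetDist_eq_top {A B : Multiset ℂ} (h : A.card ≠ B.card) : frechetDist A B = ⊤ := by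
  simp only [frechetDist, iInf_eq_top]
  intro m u v hu hv
  exact absurd (by rw [← hu, ← hv]; simp) h

end RootStability

/-!
Write `C` for the lower bound on `τ(f)`, and let `w` be a root of `f`. As `w` is a simple root, no
root of `f'` equals `w`, so all of them are at distance at least `C` from `w`. Expanding the
product over the roots of `f'` bounds its derivatives at `w`, up to constants that depend only on
`n`: `‖f⁽ᵏ⁾(w)‖ ≤ M ‖f'(w)‖ / C` for `k ≥ 2`
(`Polynomial.norm_iterate_derivative_eval_mul_pow_le`). Thus, for large `C`, `f` is nearly linear
around `w`. This is used three times.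

* Other roots of `f` are far from `w`: in the Taylor expansion of `f` at `w`, the linear term
  dominates on a fixed disc (`eq_zero_of_dominant_linear_term`).
* `Tf` has a root close to `w`: the value `(Tf)(w) = ∑ α_k f⁽ᵏ⁾(w)` is small in comparison with
  `(Tf)'(w) ≈ f'(w)`, while a polynomial `g` without roots in the disc of radius `δ` around `w`
  satisfies `δ ‖g'(w)‖ ≤ deg g · ‖g(w)‖`, because `g'/g` is the sum of the `1 / (w - r)` over the
  roots `r` of `g` (`Polynomial.exists_root_near`). No argument principle is needed.
* Hence the roots of `Tf` near the different roots of `f` are different. As `Tf` has the same degree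
  as `f`, they are all its roots, and all are simple. This matches the two multisets of roots
  (`frechetDist_roots_le`).
-/

/-! ### Polynomials whose roots are far from a point -/

theorem pow_add_mul_pow_le_succ_pow {a : ℝ} (ha : 0 ≤ a) (k : ℕ) :
    a ^ (k + 1) + (k + 1) * a ^ k ≤ (a + 1) ^ (k + 1) := by
  induction k with
  | zero => simp
  | succ k ih =>
    have h := mul_le_mul_of_nonneg_right ih (by positivity : 0 ≤ a + 1)
    have : 0 ≤ ((k : ℝ) + 1) * a ^ k := by positivity
    push_cast
    calc a ^ (k + 1 + 1) + (k + 1 + 1) * a ^ (k + 1)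
        ≤ (a ^ (k + 1) + (k + 1) * a ^ k) * (a + 1) := by ring_nf at this ⊢; linarith
      _ ≤ _ := by rw [pow_succ (a + 1) (k + 1)]; exact h

namespace Polynomial

theorem iterate_derivative_X_sub_C_mul_eval (a w : ℂ) (q : ℂ[X]) (k : ℕ) :
    (derivative^[k + 1] ((X - C a) * q)).eval w =
      (w - a) * (derivative^[k + 1] q).eval w + (k + 1) * (derivative^[k] q).eval w := by
  have h : derivative^[k + 1] (q * X) = derivative^[k + 1] q * X + (k + 1) • derivative^[k] q := by
    simpa using iterate_derivative_mul_X (n := k + 1) q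
  rw [sub_mul, iterate_derivative_sub, iterate_derivative_C_mul, mul_comm X q, h]
  simp
  ring

theorem norm_iterate_derivative_prod_eval_mul_pow_le {R : ℝ} (hR : 0 ≤ R) (w : ℂ)
    (s : Multiset ℂ) (hs : ∀ a ∈ s, R ≤ ‖w - a‖) (k : ℕ) :
    ‖(derivative^[k] (s.map fun a => X - C a).prod).eval w‖ * R ^ k ≤
      (s.card : ℝ) ^ k * ‖(s.map fun a => X - C a).prod.eval w‖ := by
  induction s using Multiset.induction_on generalizing k with
  | empty =>
    cases k with
    | zero => simp
    | succ k => simp [iterate_derivative_one]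
  | cons a s ih =>
    have ih := ih fun b hb => hs b (Multiset.mem_cons_of_mem hb)
    have ha := hs a (Multiset.mem_cons_self a s)
    set q := (s.map fun a => X - C a).prod
    rw [Multiset.map_cons, Multiset.prod_cons, Multiset.card_cons]
    cases k with
    | zero => simp
    | succ k =>
      have hprod : ‖((X - C a) * q).eval w‖ = ‖w - a‖ * ‖q.eval w‖ := by simp
      rw [iterate_derivative_X_sub_C_mul_eval, hprod]
      set x := (derivative^[k + 1] q).eval w
      set y := (derivative^[k] q).eval w
      have hk : ‖((k : ℂ) + 1)‖ = (k : ℝ) + 1 := by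
        exact_mod_cast Complex.norm_natCast (k + 1)
      calc ‖(w - a) * x + (k + 1) * y‖ * R ^ (k + 1)
          ≤ (‖w - a‖ * ‖x‖ + (k + 1) * ‖y‖) * R ^ (k + 1) := by
            gcongr
            refine (norm_add_le _ _).trans ?_
            rw [norm_mul, norm_mul, hk]
        _ = ‖w - a‖ * (‖x‖ * R ^ (k + 1)) + (k + 1) * R * (‖y‖ * R ^ k) := by ring
        _ ≤ ‖w - a‖ * ((s.card : ℝ) ^ (k + 1) * ‖q.eval w‖) +
              (k + 1) * ‖w - a‖ * ((s.card : ℝ) ^ k * ‖q.eval w‖) := by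
            refine add_le_add (mul_le_mul_of_nonneg_left (ih (k + 1)) (norm_nonneg _))
              (mul_le_mul ?_ (ih k) (by positivity) (by positivity))
            gcongr
        _ = ((s.card : ℝ) ^ (k + 1) + (k + 1) * (s.card : ℝ) ^ k) *
              (‖w - a‖ * ‖q.eval w‖) := by ring
        _ ≤ _ := by
            push_cast
            gcongr
            exact pow_add_mul_pow_le_succ_pow (by positivity) k

/-- If all roots of `p` are at distance at least `R` from `w`, then the `k`-th derivative of `p` at
`w` is at most `(deg p / R) ^ k` times the value of `p` there. -/
theorem norm_iterate_derivative_eval_mul_pow_le {R : ℝ} (hR : 0 ≤ R) (w : ℂ) (p : ℂ[X])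
    (hp : ∀ a ∈ p.roots, R ≤ ‖w - a‖) (k : ℕ) :
    ‖(derivative^[k] p).eval w‖ * R ^ k ≤ (p.natDegree : ℝ) ^ k * ‖p.eval w‖ := by
  have hsplit := (IsAlgClosed.splits p).eq_prod_roots
  have h := norm_iterate_derivative_prod_eval_mul_pow_le hR w p.roots hp k
  rw [IsAlgClosed.card_roots_eq_natDegree] at h
  set q := (p.roots.map fun a => X - C a).prod
  have h1 : (derivative^[k] p).eval w = p.leadingCoeff * (derivative^[k] q).eval w := by
    conv_lhs => rw [hsplit, iterate_derivative_C_mul]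
    simp
  have h2 : p.eval w = p.leadingCoeff * q.eval w := by
    conv_lhs => rw [hsplit]
    simp
  rw [h1, h2, norm_mul, norm_mul]
  calc ‖p.leadingCoeff‖ * ‖(derivative^[k] q).eval w‖ * R ^ k
      = ‖p.leadingCoeff‖ * (‖(derivative^[k] q).eval w‖ * R ^ k) := by ring
    _ ≤ ‖p.leadingCoeff‖ * ((p.natDegree : ℝ) ^ k * ‖q.eval w‖) := by gcongr
    _ = _ := by ring

/-- A polynomial whose value at `w` is small compared with its derivative there has a root close
to `w`. -/
theorem exists_root_near {g : ℂ[X]} {w : ℂ} {δ : ℝ} (hδ : 0 < δ)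
    (h : g.natDegree * ‖g.eval w‖ < δ * ‖(derivative g).eval w‖) :
    ∃ r, g.IsRoot r ∧ ‖w - r‖ < δ := by
  by_contra! hno
  refine absurd h (not_lt.2 ?_)
  have := norm_iterate_derivative_eval_mul_pow_le hδ.le w g
    (fun a ha => hno a (isRoot_of_mem_roots ha)) 1
  simpa [mul_comm δ] using this

end Polynomial

open Polynomial

/-! ### Separation of the roots -/

/-- If a polynomial `p` vanishes at `w` and its higher derivatives at `w` are small in comparison
with `p'(w)`, then `p` has no other root in a disc around `w`. -/
theorem eq_zero_of_dominant_linear_term {p : ℂ[X]} {n : ℕ} (hpn : p.natDegree ≤ n) {w z : ℂ}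
    {η B : ℝ} (hη : 0 ≤ η) (hB : 1 ≤ B) (hz : ‖z‖ ≤ B) (hw : p.eval w = 0)
    (hw' : (derivative p).eval w ≠ 0) (hwz : p.eval (w + z) = 0)
    (hsmall : ∀ k, 2 ≤ k → ‖(derivative^[k] p).eval w‖ ≤ η * ‖(derivative p).eval w‖)
    (hηB : n * η * B ^ n < 1) : z = 0 := by
  by_contra hz0
  have hexp : p.eval (w + z) =
      ∑ k ∈ Finset.range (n + 2), (taylor w p).coeff k * z ^ k := by
    rw [← eval_eq_sum_range' (by rw [natDegree_taylor]; omega), taylor_eval, add_comm]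
  rw [hwz, Finset.sum_range_succ', Finset.sum_range_succ'] at hexp
  simp only [taylor_coeff_zero, hw, taylor_coeff_one, zero_mul, zero_add, pow_one, add_zero] at hexp
  have hlin : (derivative p).eval w * z =
      -∑ k ∈ Finset.range n, (taylor w p).coeff (k + 1 + 1) * z ^ (k + 1 + 1) := by
    linear_combination -hexp
  have hcoeff : ∀ k, 2 ≤ k → ‖(taylor w p).coeff k‖ ≤ η * ‖(derivative p).eval w‖ := by
    intro k hk
    refine le_trans ?_ (hsmall k hk)
    have hfac : (derivative^[k] p).eval w = k.factorial * (hasseDeriv k p).eval w := by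
      rw [← factorial_smul_hasseDeriv, LinearMap.smul_apply, eval_smul, nsmul_eq_mul]
    rw [taylor_coeff, hfac, norm_mul, Complex.norm_natCast]
    exact le_mul_of_one_le_left (norm_nonneg _) (Nat.one_le_cast.2 k.factorial_pos)
  have hD : 0 < ‖(derivative p).eval w‖ * ‖z‖ :=
    mul_pos (norm_pos_iff.2 hw') (norm_pos_iff.2 hz0)
  have hle : ‖(derivative p).eval w‖ * ‖z‖ ≤
      n * η * B ^ n * (‖(derivative p).eval w‖ * ‖z‖) := by
    calc ‖(derivative p).eval w‖ * ‖z‖ = ‖(derivative p).eval w * z‖ := (norm_mul _ _).symm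
      _ ≤ ∑ k ∈ Finset.range n, ‖(taylor w p).coeff (k + 1 + 1) * z ^ (k + 1 + 1)‖ := by
          rw [hlin, norm_neg]
          exact norm_sum_le _ _
      _ ≤ ∑ _k ∈ Finset.range n, η * B ^ n * (‖(derivative p).eval w‖ * ‖z‖) := by
          refine Finset.sum_le_sum fun k hk => ?_
          rw [Finset.mem_range] at hk
          have hpow : ‖z‖ ^ (k + 1) ≤ B ^ n :=
            (pow_le_pow_left₀ (norm_nonneg z) hz _).trans (pow_le_pow_right₀ hB hk)
          calc ‖(taylor w p).coeff (k + 1 + 1) * z ^ (k + 1 + 1)‖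
              = ‖(taylor w p).coeff (k + 1 + 1)‖ * (‖z‖ ^ (k + 1) * ‖z‖) := by
                rw [norm_mul, norm_pow, pow_succ]
            _ ≤ η * ‖(derivative p).eval w‖ * (B ^ n * ‖z‖) := by
                gcongr
                exact hcoeff _ (by omega)
            _ = _ := by ring
      _ = _ := by
          rw [Finset.sum_const, Finset.card_range, nsmul_eq_mul]
          ring
  nlinarith

/-! ### Matching roots -/

namespace RootStability

theorem frechetDist_map_self_le (s : Multiset ℂ) (r : ℂ → ℂ) {δ : ℝ}
    (hr : ∀ w ∈ s, ‖w - r w‖ ≤ δ) : frechetDist s (s.map r) ≤ ENNReal.ofReal δ := by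
  obtain ⟨l, rfl⟩ : ∃ l : List ℂ, (l : Multiset ℂ) = s := ⟨s.toList, s.coe_toList⟩
  have hl : Multiset.map l.get Finset.univ.val = (l : Multiset ℂ) := by
    rw [Fin.univ_val_map, List.ofFn_get]
  rw [← hl, Multiset.map_map, frechetDist_map]
  refine iInf_le_of_le (Equiv.refl _) (iSup_le fun k => ENNReal.ofReal_le_ofReal ?_)
  exact hr _ (Multiset.mem_coe.2 (l.get_mem k))

/-- If `f` has simple, `2δ`-separated roots, `g` has the same degree as `f`, and `g` has a root
within `δ` of each root of `f`, then these are all the roots of `g`. -/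
theorem frechetDist_roots_le {f g : ℂ[X]} (hg : g ≠ 0) (hdeg : g.natDegree = f.natDegree)
    (hf : f.roots.Nodup) {δ : ℝ}
    (hnear : ∀ w ∈ f.roots, ∃ r, g.IsRoot r ∧ ‖w - r‖ ≤ δ)
    (hsep : ∀ w ∈ f.roots, ∀ w' ∈ f.roots, ‖w' - w‖ ≤ 2 * δ → w = w') :
    frechetDist f.roots g.roots ≤ ENNReal.ofReal δ := by
  choose! r hroot hdist using hnear
  have hinj : ∀ w ∈ f.roots, ∀ w' ∈ f.roots, r w = r w' → w = w' := by
    intro w hw w' hw' h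
    refine hsep w hw w' hw' ?_
    have h1 := hdist w hw
    have h2 := hdist w' hw'
    rw [h, norm_sub_rev] at h1
    calc ‖w' - w‖ = ‖(w' - r w') + (r w' - w)‖ := by rw [sub_add_sub_cancel]
      _ ≤ ‖w' - r w'‖ + ‖r w' - w‖ := norm_add_le _ _
      _ ≤ 2 * δ := by linarith
  have hnodup : (f.roots.map r).Nodup := hf.map_on hinj
  have hsub : f.roots.map r ≤ g.roots := by
    rw [Multiset.le_iff_subset hnodup]
    intro x hx
    obtain ⟨w, hw, rfl⟩ := Multiset.mem_map.1 hx
    exact (mem_roots hg).2 (hroot w hw)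
  have heq : f.roots.map r = g.roots := by
    refine Multiset.eq_of_le_of_card_le hsub ?_
    rw [Multiset.card_map, IsAlgClosed.card_roots_eq_natDegree,
      IsAlgClosed.card_roots_eq_natDegree, hdeg]
  rw [← heq]
  exact frechetDist_map_self_le _ r hdist

/-! ### The critical points and the operator -/

theorem le_norm_sub_of_ofReal_lt_tau {f : ℂ[X]} {R : ℝ} (h : ENNReal.ofReal R < tau f) {w v : ℂ}
    (hw : f.eval w = 0) (hv : (derivative f).eval v = 0) (hvw : v ≠ w) : R ≤ ‖w - v‖ := by
  have h1 : tau f ≤ ENNReal.ofReal ‖w - v‖ :=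
    iInf₂_le_of_le w hw (iInf₂_le v ⟨hv, hvw⟩)
  exact (ENNReal.ofReal_le_ofReal_iff (norm_nonneg _)).1 (h.le.trans h1)

theorem coe_diffOp_pow (n k : ℕ) (f : PolyLE n) :
    (((diffOp n ^ k) f : PolyLE n) : ℂ[X]) = derivative^[k] (f : ℂ[X]) := by
  induction k with
  | zero => simp
  | succ k ih =>
    rw [pow_succ', Module.End.mul_apply, Function.iterate_succ_apply', ← ih]
    rfl

theorem coe_id_add_sum_diffOp_pow (n : ℕ) (α : ℕ → ℂ) (f : PolyLE n) :
    (((LinearMap.id + ∑ k ∈ Finset.Icc 2 n, α k • diffOp n ^ k : PolyLE n →ₗ[ℂ] PolyLE n) f :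
      PolyLE n) : ℂ[X]) =
      f + ∑ k ∈ Finset.Icc 2 n, α k • derivative^[k] (f : ℂ[X]) := by
  simp [LinearMap.sum_apply, coe_diffOp_pow]

theorem degree_sum_smul_iterate_derivative_lt (s : Finset ℕ) (hs : 0 ∉ s) (α : ℕ → ℂ) {f : ℂ[X]}
    (hf : f ≠ 0) : (∑ k ∈ s, α k • derivative^[k] f).degree < f.degree := by
  refine (degree_sum_le _ _).trans_lt ((Finset.sup_lt_iff ?_).2 fun k hk => ?_)
  · exact bot_lt_iff_ne_bot.2 (degree_ne_bot.2 hf)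
  · refine (degree_smul_le _ _).trans_lt ?_
    obtain ⟨j, rfl⟩ := Nat.exists_eq_succ_of_ne_zero fun h : k = 0 => hs (h ▸ hk)
    rw [Function.iterate_succ_apply]
    have hle : ∀ (j : ℕ) (p : ℂ[X]), (derivative^[j] p).degree ≤ p.degree := by
      intro j
      induction j with
      | zero => exact fun p => le_rfl
      | succ j ih => exact fun p => (ih _).trans degree_derivative_le
    exact (hle j _).trans_lt (degree_derivative_lt hf)

/-- If all critical points of `f` are at distance at least `R ≥ 1` from `w`, the derivatives of `f`
at `w` of order `k ≥ 2` are of order `1 / R` in comparison with `f'(w)`. -/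
theorem norm_iterate_derivative_eval_le {f : ℂ[X]} {n : ℕ} (hfn : f.natDegree ≤ n) {w : ℂ} {R : ℝ}
    (hR : 1 ≤ R) (hcrit : ∀ v ∈ (derivative f).roots, R ≤ ‖w - v‖) {k : ℕ} (hk : 2 ≤ k) :
    ‖(derivative^[k] f).eval w‖ ≤ (n + 1) ^ n / R * ‖(derivative f).eval w‖ := by
  have hR0 : 0 < R := by linarith
  rcases le_or_gt k n with hkn | hkn
  · obtain ⟨j, rfl⟩ : ∃ j, k = j + 1 := ⟨k - 1, by omega⟩
    have h := norm_iterate_derivative_eval_mul_pow_le hR0.le w (derivative f) hcrit j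
    rw [← Function.iterate_succ_apply] at h
    have hdeg : ((derivative f).natDegree : ℝ) ≤ n + 1 := by
      have : (derivative f).natDegree ≤ n + 1 := by
        have := natDegree_derivative_le f
        omega
      exact_mod_cast this
    have hRj : R ≤ R ^ j := by simpa using pow_le_pow_right₀ hR (show 1 ≤ j by omega)
    rw [div_mul_eq_mul_div, le_div_iff₀ hR0]
    calc ‖(derivative^[j + 1] f).eval w‖ * R ≤ ‖(derivative^[j + 1] f).eval w‖ * R ^ j := by gcongr
      _ ≤ ((derivative f).natDegree : ℝ) ^ j * ‖(derivative f).eval w‖ := h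
      _ ≤ (n + 1) ^ j * ‖(derivative f).eval w‖ := by gcongr
      _ ≤ _ := by
          gcongr
          · linarith [(Nat.cast_nonneg n : (0 : ℝ) ≤ n)]
          · omega
  · rw [iterate_derivative_eq_zero (by omega)]
    simp only [eval_zero, norm_zero]
    positivity

/-- The operator `T` nearly fixes the value `0` of `f` at `w` and the derivative `f'(w)`, if the
higher derivatives of `f` at `w` are small; so `Tf` has a root near `w`. -/
theorem exists_root_add_sum_near {f g : ℂ[X]} {n : ℕ} (α : ℕ → ℂ)
    (hg : g = f + ∑ k ∈ Finset.Icc 2 n, α k • derivative^[k] f) (hgn : g.natDegree ≤ n)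
    {w : ℂ} {η δ : ℝ} (hδ : 0 < δ) (hw : f.eval w = 0) (hw' : (derivative f).eval w ≠ 0)
    (hsmall : ∀ k, 2 ≤ k → ‖(derivative^[k] f).eval w‖ ≤ η * ‖(derivative f).eval w‖)
    (hη : (∑ k ∈ Finset.Icc 2 n, ‖α k‖) * η * (n + δ) < δ) :
    ∃ r, g.IsRoot r ∧ ‖w - r‖ < δ := by
  set A := ∑ k ∈ Finset.Icc 2 n, ‖α k‖ with hA
  set D := ‖(derivative f).eval w‖ with hD
  have hD0 : 0 < D := norm_pos_iff.2 hw'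
  have hsum : ∀ i : ℕ, ‖∑ k ∈ Finset.Icc 2 n, α k * (derivative^[k + i] f).eval w‖ ≤
      A * (η * D) := by
    intro i
    refine (norm_sum_le _ _).trans ?_
    rw [hA, Finset.sum_mul]
    refine Finset.sum_le_sum fun k hk => ?_
    rw [norm_mul]
    exact mul_le_mul_of_nonneg_left
      (hsmall _ (by have := (Finset.mem_Icc.1 hk).1; omega)) (norm_nonneg _)
  have h0 : ‖g.eval w‖ ≤ A * (η * D) := by
    have : g.eval w = ∑ k ∈ Finset.Icc 2 n, α k * (derivative^[k + 0] f).eval w := by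
      simp [hg, hw, eval_finsetSum]
    rw [this]
    exact hsum 0
  have h1 : D - A * (η * D) ≤ ‖(derivative g).eval w‖ := by
    have : (derivative g).eval w = (derivative f).eval w -
        -∑ k ∈ Finset.Icc 2 n, α k * (derivative^[k + 1] f).eval w := by
      simp [hg, eval_finsetSum, Function.iterate_succ_apply']
    rw [this]
    refine le_trans ?_ (norm_sub_norm_le _ _)
    rw [norm_neg]
    linarith [hsum 1]
  refine exists_root_near hδ ?_
  have hgn' : (g.natDegree : ℝ) ≤ n := by exact_mod_cast hgn
  calc (g.natDegree : ℝ) * ‖g.eval w‖ ≤ n * (A * (η * D)) := by gcongr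
    _ < δ * (D - A * (η * D)) := by nlinarith
    _ ≤ _ := by gcongr

end RootStability

open RootStability in
theorem mainTheorem3 (n : ℕ) (hn : 2 ≤ n) (α : ℕ → ℂ) (T : PolyLE n →ₗ[ℂ] PolyLE n)
    (hT : T = LinearMap.id + ∑ k ∈ Finset.Icc 2 n, α k • diffOp n ^ k)
    (ε : ℝ) (hε : 0 < ε) :
    ∃ C : ℝ, 0 < C ∧
      ∀ f : PolyLE n, 0 < (f : Polynomial ℂ).natDegree → (f : Polynomial ℂ).roots.Nodup →
        ENNReal.ofReal C < tau (f : Polynomial ℂ) →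
          frechetDist (f : Polynomial ℂ).roots (T f : Polynomial ℂ).roots < ENNReal.ofReal ε := by
  have hδ : 0 < ε / 2 := by positivity
  set δ := ε / 2 with hδdef
  set A := ∑ k ∈ Finset.Icc 2 n, ‖α k‖
  have hA : 0 ≤ A := Finset.sum_nonneg fun _ _ => norm_nonneg _
  set M : ℝ := (n + 1) ^ n
  have hM : 0 ≤ M := by positivity
  set B : ℝ := 1 + 2 * δ with hB
  -- The second summand of `K` gives a root of `Tf` near each root of `f`, the third one separates
  -- the roots of `f`.
  set K : ℝ := 1 + A * M * (n + δ) / δ + n * M * B ^ n with hK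
  have hK1 : 1 ≤ K := by
    have : 0 ≤ A * M * (n + δ) / δ + n * M * B ^ n := by positivity
    linarith
  have hK0 : 0 < K := by linarith
  have hKT : A * (M / K) * (n + δ) < δ := by
    have : A * M * (n + δ) / δ < K := by
      have : 0 ≤ n * M * B ^ n := by positivity
      linarith
    rw [div_lt_iff₀ hδ] at this
    rw [mul_div_assoc', div_mul_eq_mul_div, div_lt_iff₀ hK0]
    linarith
  have hKsep : n * (M / K) * B ^ n < 1 := by
    have : n * M * B ^ n < K := by
      have : 0 ≤ A * M * (n + δ) / δ := by positivity
      linarith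
    rwa [mul_div_assoc', div_mul_eq_mul_div, div_lt_one hK0]
  refine ⟨K, hK0, fun f hdeg hnodup htau => ?_⟩
  have hTf : ((T f : PolyLE n) : ℂ[X]) =
      f + ∑ k ∈ Finset.Icc 2 n, α k • derivative^[k] (f : ℂ[X]) := by
    rw [hT, coe_id_add_sum_diffOp_pow]
  have hfn : (f : ℂ[X]).natDegree ≤ n := natDegree_le_of_degree_le (mem_degreeLE.1 f.2)
  generalize ((T f : PolyLE n) : ℂ[X]) = g at hTf ⊢
  generalize (f : ℂ[X]) = p at *
  have hp0 : p ≠ 0 := by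
    rintro rfl
    simp at hdeg
  have hgdeg : g.degree = p.degree := by
    rw [hTf]
    exact degree_add_eq_left_of_degree_lt
      (degree_sum_smul_iterate_derivative_lt _ (by simp) α hp0)
  have hg0 : g ≠ 0 := by
    rw [← degree_ne_bot, hgdeg]
    exact degree_ne_bot.2 hp0
  have hgnat : g.natDegree = p.natDegree := natDegree_eq_of_degree_eq hgdeg
  have hroot : ∀ w ∈ p.roots, p.eval w = 0 := fun w hw => isRoot_of_mem_roots hw
  have hsimple : ∀ w ∈ p.roots, (derivative p).eval w ≠ 0 := by
    intro w hw h
    have hmult : 1 < p.rootMultiplicity w :=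
      (one_lt_rootMultiplicity_iff_isRoot hp0).2 ⟨hroot w hw, h⟩
    have := Multiset.nodup_iff_count_le_one.1 hnodup w
    rw [count_roots] at this
    omega
  have hsmall : ∀ w ∈ p.roots, ∀ k, 2 ≤ k →
      ‖(derivative^[k] p).eval w‖ ≤ M / K * ‖(derivative p).eval w‖ := by
    intro w hw k hk
    refine norm_iterate_derivative_eval_le hfn hK1 (fun v hv => ?_) hk
    have hv0 : (derivative p).eval v = 0 := isRoot_of_mem_roots hv
    refine le_norm_sub_of_ofReal_lt_tau htau (hroot w hw) hv0 ?_
    rintro rfl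
    exact hsimple v hw hv0
  refine (frechetDist_roots_le (δ := δ) hg0 hgnat hnodup ?_ ?_).trans_lt ?_
  · intro w hw
    obtain ⟨r, hr, hwr⟩ := exists_root_add_sum_near α hTf (hgnat.trans_le hfn) hδ (hroot w hw)
      (hsimple w hw) (hsmall w hw) hKT
    exact ⟨r, hr, hwr.le⟩
  · intro w hw w' hw' hdist
    have hz : w' - w = 0 := by
      refine eq_zero_of_dominant_linear_term (w := w) (η := M / K) (B := B) hfn (by positivity)
        (by linarith) (by linarith) (hroot w hw) (hsimple w hw) ?_ (hsmall w hw) hKsep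
      rw [add_sub_cancel]
      exact hroot w' hw'
    exact (sub_eq_zero.1 hz).symm
  · rw [ENNReal.ofReal_lt_ofReal_iff hε]
    linarith
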